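/- Let $T\colon X\to X$ be a continuous map on a compact metric space $(X,\rho)$, let $\Phi=\{\phi_1,\dots,\phi_d\}$ be a family of continuous functions $\phi_i\colon X\to\mathbb R$, and let $\mathcal M$ be the set of $T$-invariant Borel probability measures on $X$ with the weak$^*$ topology. For $\mu\in\mathcal M$ let $h_\mu(T)$ be the Kolmogorov--Sinai entropy and $\int_X\Phi\,d\mu=(\int_X\phi_1\,d\mu,\dots,\int_X\phi_d\,d\mu)$. For a continuous function $\phi\colon X\to\mathbb R$ let $$P(\phi)=\lim_{\epsilon\to0}\limsup_{n\to\infty}\frac1n\log\sup_E\sum_{x\in E}\exp\sum_{k=0}^{n-1}\phi(T^kx)$$ be its topological pressure, the supremum being over all $(n,\epsilon)$-separated sets $E$ (that is, $\max_{0\le k<n}\rho(T^kx,T^ky)>\epsilon$ for all distinct $x,y\in E$); an equilibrium measure for $\phi$ is a measure $\mu\in\mathcal M$ with $P(\phi)=h_\mu(T)+\int_X\phi\,d\mu$. Put $$L(\Phi)=\Bigl\{\int_X\Phi\,d\mu:\mu\in\mathcal M\Bigr\}\subset\mathbb R^d,\qquad h(z)=\sup\Bigl\{h_\mu(T):\mu\in\mathcal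 M,\ \int_X\Phi\,d\mu=z\Bigr\}\quad(z\in L(\Phi)).$$ Let $2\le r\le\omega$ (so $r$ is an integer, $\infty$ or $\omega$, the last meaning real analytic) and suppose that the pair $(T,\Phi)$ is $C^r$-regular, that is: 1. each function in $\operatorname{span}\{\phi_1,\dots,\phi_d,1\}$ has a unique equilibrium measure; 2. for each $z\in\operatorname{int}L(\Phi)$ the map $\mathbb R^d\ni q\mapsto P(\langle q,\Phi-z\rangle)$ is real valued, of class $C^r$ and strictly convex, and its second derivative at each $q\in\mathbb R^d$ is a positive definite bilinear form; 3. the entropy map $\mathcal M\ni\mu\mapsto h_\mu(T)$ is real valued and upper semicontinuous. Then $h$ is finite, upper semicontinuous and concave on $L(\Phi)$ (in particular, $L(\Phi)$ is convex). -/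

import Mathlib

open MeasureTheory Filter Topology Set
open scoped ENNReal ContDiff

noncomputable section

namespace NonlinearPressure

/-! ### Kolmogorov–Sinai entropy

A finite measurable partition of `X` is given by a measurable labelling `ξ : X → Fin k`; its cells
are the fibres of `ξ` (empty cells are harmless because `0 log 0 = 0`). -/

section Entropy

variable {X : Type*} [MeasurableSpace X]

/-- The labelling of the joined partition `⋁_{i < n} T⁻ⁱ ξ`. -/
def joinedLabel {k : ℕ} (T : X → X) (ξ : X → Fin k) (n : ℕ) : X → (Fin n → Fin k) :=
  fun x i => ξ (T^[i] x)

/-- Shannon entropy `H_μ(η) = -∑ μ(C) log μ(C)` of the finite partition into the fibres of `η`. -/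
def partitionEntropy {ι : Type*} [Fintype ι] (μ : Measure X) (η : X → ι) : ℝ :=
  ∑ a, Real.negMulLog (μ.real (η ⁻¹' {a}))

/-- The entropy `h_μ(T, ξ) = lim (1/n) H_μ(⋁_{i < n} T⁻ⁱ ξ)` of a partition. For an invariant
probability measure the sequence `n ↦ H_μ(⋁_{i < n} T⁻ⁱ ξ)` is subadditive, so the limit exists
and coincides with the lower limit. -/
def entropyOfPartition {k : ℕ} (T : X → X) (μ : Measure X) (ξ : X → Fin k) : ℝ≥0∞ :=
  liminf (fun n : ℕ => ENNReal.ofReal (partitionEntropy μ (joinedLabel T ξ n) / n)) atTop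

/-- The Kolmogorov–Sinai entropy `h_μ(T)`: the supremum of `h_μ(T, ξ)` over all finite measurable
partitions `ξ`. -/
def metricEntropy (T : X → X) (μ : Measure X) : ℝ≥0∞ :=
  ⨆ (k : ℕ) (ξ : X → Fin k) (_ : Measurable ξ), entropyOfPartition T μ ξ

/-- The set of `T`-invariant probability measures. -/
def invariantMeasures (T : X → X) : Set (ProbabilityMeasure X) :=
  {μ | MeasurePreserving T (μ : Measure X) (μ : Measure X)}

end Entropy

/-! ### Classical topological pressure -/

section Pressure

variable {X : Type*} [MetricSpace X]

/-- `E` is `(n, ε)`-separated: `max_{k < n} d(Tᵏ x, Tᵏ y) > ε` for distinct `x, y ∈ E`.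
(In a compact space such sets are automatically finite.) -/
def IsSeparated (T : X → X) (n : ℕ) (ε : ℝ) (E : Finset X) : Prop :=
  ∀ x ∈ E, ∀ y ∈ E, x ≠ y → ∃ k < n, ε < dist (T^[k] x) (T^[k] y)

/-- `sup_E ∑_{x ∈ E} exp (S_n φ(x))` over all `(n, ε)`-separated sets `E`. -/
def separatedSum (T : X → X) (φ : C(X, ℝ)) (n : ℕ) (ε : ℝ) : ℝ≥0∞ :=
  ⨆ (E : Finset X) (_ : IsSeparated T n ε E),
    ∑ x ∈ E, ENNReal.ofReal (Real.exp (birkhoffSum T φ n x))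

/-- The topological pressure
`P(φ) = lim_{ε → 0} limsup_n (1/n) log sup_E ∑_{x ∈ E} exp (S_n φ(x))`.
The inner expression increases as `ε` decreases to `0`, so the limit is the supremum over `ε > 0`. -/
def pressure (T : X → X) (φ : C(X, ℝ)) : EReal :=
  ⨆ (ε : ℝ) (_ : 0 < ε),
    limsup (fun n : ℕ => ENNReal.log (separatedSum T φ n ε) / (n : EReal)) atTop

end Pressure

/-! ### Regular pairs -/

section Regular

variable {X : Type*} [MetricSpace X] [MeasurableSpace X] {d : ℕ}

/-- `μ` is an equilibrium measure for `φ` with respect to the classical topological pressure. -/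
def IsEquilibriumMeasure (T : X → X) (φ : C(X, ℝ)) (μ : ProbabilityMeasure X) : Prop :=
  μ ∈ invariantMeasures T ∧
    pressure T φ = (metricEntropy T (μ : Measure X) : EReal) + ((∫ x, φ x ∂(μ : Measure X) : ℝ) : EReal)

/-- The vector `∫ Φ dμ = (∫ φ₁ dμ, …, ∫ φ_d dμ)`. -/
def integralVec (Φ : Fin d → C(X, ℝ)) (μ : ProbabilityMeasure X) : EuclideanSpace ℝ (Fin d) :=
  WithLp.toLp 2 fun i => ∫ x, Φ i x ∂(μ : Measure X)

/-- The set `L(Φ)` of all vectors `∫ Φ dμ` with `μ` invariant. -/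
def rotationSet (T : X → X) (Φ : Fin d → C(X, ℝ)) : Set (EuclideanSpace ℝ (Fin d)) :=
  integralVec Φ '' invariantMeasures T

/-- The set `M(z)` of invariant probability measures with `∫ Φ dμ = z`. -/
def levelMeasures (T : X → X) (Φ : Fin d → C(X, ℝ)) (z : EuclideanSpace ℝ (Fin d)) :
    Set (ProbabilityMeasure X) :=
  {μ ∈ invariantMeasures T | integralVec Φ μ = z}

/-- `h(z) = sup {h_μ(T) : μ ∈ M(z)}`, with values in `[0, ∞]`. -/
def levelEntropy (T : X → X) (Φ : Fin d → C(X, ℝ)) (z : EuclideanSpace ℝ (Fin d)) : ℝ≥0∞ :=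
  ⨆ μ ∈ levelMeasures T Φ z, metricEntropy T (μ : Measure X)

/-- The function `⟨q, Φ - z⟩ = ∑ qᵢ (φᵢ - zᵢ)`. -/
def pairing (Φ : Fin d → C(X, ℝ)) (q z : EuclideanSpace ℝ (Fin d)) : C(X, ℝ) :=
  ∑ i, q i • (Φ i - ContinuousMap.const X (z i))

/-- The pair `(T, Φ)` is `C^r`-regular; `r` ranges over `ℕ ∪ {∞, ω}`. -/
structure IsRegularPair [BorelSpace X] (r : WithTop ℕ∞) (T : X → X) (Φ : Fin d → C(X, ℝ)) :
    Prop where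
  /-- Each function in `span {φ₁, …, φ_d, 1}` has a unique equilibrium measure. -/
  existsUnique_equilibrium : ∀ ψ ∈ Submodule.span ℝ (Set.range Φ ∪ {1}),
    ∃! μ : ProbabilityMeasure X, IsEquilibriumMeasure T ψ μ
  /-- For `z ∈ int L(Φ)` the map `q ↦ P(⟨q, Φ - z⟩)` is real valued. -/
  pressure_finite : ∀ z ∈ interior (rotationSet T Φ), ∀ q,
    pressure T (pairing Φ q z) ≠ ⊤ ∧ pressure T (pairing Φ q z) ≠ ⊥
  /-- For `z ∈ int L(Φ)` the map `q ↦ P(⟨q, Φ - z⟩)` is of class `C^r`. -/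
  pressure_contDiff : ∀ z ∈ interior (rotationSet T Φ),
    ContDiff ℝ r fun q => (pressure T (pairing Φ q z)).toReal
  /-- For `z ∈ int L(Φ)` the map `q ↦ P(⟨q, Φ - z⟩)` is strictly convex. -/
  pressure_strictConvex : ∀ z ∈ interior (rotationSet T Φ),
    StrictConvexOn ℝ univ fun q => (pressure T (pairing Φ q z)).toReal
  /-- For `z ∈ int L(Φ)` the second derivative of `q ↦ P(⟨q, Φ - z⟩)` is positive definite. -/
  pressure_posDef : ∀ z ∈ interior (rotationSet T Φ), ∀ q v, v ≠ 0 →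
    0 < iteratedFDeriv ℝ 2 (fun q => (pressure T (pairing Φ q z)).toReal) q ![v, v]
  /-- The entropy map `μ ↦ h_μ(T)` is real valued on the invariant measures. -/
  entropy_finite : ∀ μ ∈ invariantMeasures T, metricEntropy T (μ : Measure X) ≠ ⊤
  /-- The entropy map is upper semicontinuous on the invariant measures, in the weak* topology. -/
  entropy_usc : UpperSemicontinuousOn
    (fun μ : ProbabilityMeasure X => (metricEntropy T (μ : Measure X)).toReal) (invariantMeasures T)

end Regular

end NonlinearPressure

end

open scoped NNReal

namespace NonlinearPressure

/-! ### Shannon entropy -/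

/-! The map `integralVec Φ` is continuous and affine on the weak* compact convex set of invariant
measures, and `levelEntropy` is the supremum of the entropy over its fibres. The fibres are compact
and entropy is finite and upper semicontinuous, so the supremum is attained
(`exists_metricEntropy_eq_levelEntropy`); this gives finiteness. Superlevel sets of `h` are then
images of compact superlevel sets of the entropy, hence closed. Concavity follows by mixing
maximizers, once the entropy itself is known to be concave in the measure (`metricEntropy_concave`);
that comes from concavity of `Real.negMulLog` on each cell and passage to common refinements. -/

lemma negMulLog_sum_le {ι : Type*} (s : Finset ι) (p : ι → ℝ) (hp : ∀ i ∈ s, 0 ≤ p i) :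
    Real.negMulLog (∑ i ∈ s, p i) ≤ ∑ i ∈ s, Real.negMulLog (p i) := by
  rw [Real.negMulLog, neg_mul, Finset.sum_mul, ← Finset.sum_neg_distrib]
  refine Finset.sum_le_sum fun i hi => ?_
  rw [Real.negMulLog, neg_mul, neg_le_neg_iff]
  -- Each term is at most the sum, so monotonicity of the logarithm suffices; it needs `0 < p i`,
  -- and for `p i = 0` both products vanish.
  rcases (hp i hi).eq_or_lt with h | h
  · simp [← h]
  · exact mul_le_mul_of_nonneg_left
      (Real.log_le_log h (Finset.single_le_sum hp hi)) h.le

section Entropy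

variable {X : Type*} [MeasurableSpace X]

/-- Coarsening a partition decreases its entropy. -/
lemma partitionEntropy_comp_le {ι κ : Type*} [Fintype ι] [Fintype κ] (μ : Measure X)
    [IsFiniteMeasure μ] {η : X → ι} (hη : ∀ a, MeasurableSet (η ⁻¹' {a})) (f : ι → κ) :
    partitionEntropy μ (f ∘ η) ≤ partitionEntropy μ η := by
  classical
  have hcell (b : κ) : μ.real ((f ∘ η) ⁻¹' {b}) =
      ∑ a with f a = b, μ.real (η ⁻¹' {a}) := by
    rw [sum_measureReal_preimage_singleton _ fun a _ => hη a]
    congr 1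
    ext x
    simp
  simp only [partitionEntropy, hcell]
  rw [← Finset.sum_fiberwise Finset.univ f fun a => Real.negMulLog (μ.real (η ⁻¹' {a}))]
  exact Finset.sum_le_sum fun b _ => negMulLog_sum_le _ _ fun _ _ => measureReal_nonneg

/-- The entropy of a partition is concave in the measure. -/
lemma partitionEntropy_concave {ι : Type*} [Fintype ι] (μ ν : Measure X) [IsFiniteMeasure μ]
    [IsFiniteMeasure ν] (η : X → ι) {a b : ℝ≥0} (hab : a + b = 1) :
    a * partitionEntropy μ η + b * partitionEntropy ν η ≤
      partitionEntropy (a • μ + b • ν) η := by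
  simp only [partitionEntropy, Finset.mul_sum, ← Finset.sum_add_distrib]
  refine Finset.sum_le_sum fun c _ => ?_
  rw [measureReal_add_apply, measureReal_nnreal_smul_apply, measureReal_nnreal_smul_apply]
  exact Real.concaveOn_negMulLog.2 (mem_Ici.2 measureReal_nonneg) (mem_Ici.2 measureReal_nonneg)
    a.coe_nonneg b.coe_nonneg (by exact_mod_cast hab)

lemma partitionEntropy_nonneg {ι : Type*} [Fintype ι] (μ : Measure X) [IsProbabilityMeasure μ]
    (η : X → ι) : 0 ≤ partitionEntropy μ η :=
  Finset.sum_nonneg fun _ _ => Real.negMulLog_nonneg measureReal_nonneg measureReal_le_one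

/-! ### Concavity of the Kolmogorov–Sinai entropy -/

lemma measurable_joinedLabel {k : ℕ} {T : X → X} (hT : Measurable T) {ξ : X → Fin k}
    (hξ : Measurable ξ) (n : ℕ) : Measurable (joinedLabel T ξ n) :=
  measurable_pi_lambda _ fun i => hξ.comp (hT.iterate i)

lemma entropyOfPartition_comp_le {k l : ℕ} {T : X → X} (hT : Measurable T) (μ : Measure X)
    [IsFiniteMeasure μ] {ξ : X → Fin k} (hξ : Measurable ξ) (f : Fin k → Fin l) :
    entropyOfPartition T μ (f ∘ ξ) ≤ entropyOfPartition T μ ξ := by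
  refine liminf_le_liminf (Eventually.of_forall fun n => ?_)
  -- Relabelling by `f` commutes with joining: it acts coordinatewise on itineraries.
  have h := partitionEntropy_comp_le μ
    (fun c => measurable_joinedLabel hT hξ n (measurableSet_singleton c)) (f ∘ ·)
  exact ENNReal.ofReal_le_ofReal (div_le_div_of_nonneg_right h n.cast_nonneg)

/-- Tail infima increase with the starting index, so the two suprema can be taken along the same
index. This is the direction concavity needs, so existence of the entropy limit is never used. -/
lemma liminf_add_liminf_le (u v : ℕ → ℝ≥0∞) :
    liminf u atTop + liminf v atTop ≤ liminf (fun n => u n + v n) atTop := by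
  simp only [liminf_eq_iSup_iInf_of_nat]
  rw [ENNReal.iSup_add_iSup_of_monotone]
  · exact iSup_mono fun n => le_iInf₂ fun i hi =>
      add_le_add (iInf₂_le i hi) (iInf₂_le i hi)
  all_goals exact fun m n hmn => le_iInf₂ fun i hi => iInf₂_le i (hmn.trans hi)

lemma entropyOfPartition_concave {k : ℕ} (T : X → X) (μ ν : Measure X) [IsProbabilityMeasure μ]
    [IsProbabilityMeasure ν] (ξ : X → Fin k) {a b : ℝ≥0} (hab : a + b = 1) :
    a * entropyOfPartition T μ ξ + b * entropyOfPartition T ν ξ ≤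
      entropyOfPartition T (a • μ + b • ν) ξ := by
  unfold entropyOfPartition
  rw [← ENNReal.liminf_const_mul_of_ne_top ENNReal.coe_ne_top,
    ← ENNReal.liminf_const_mul_of_ne_top ENNReal.coe_ne_top]
  refine (liminf_add_liminf_le _ _).trans
    (liminf_le_liminf (Eventually.of_forall fun n => ?_))
  have hμ := div_nonneg (partitionEntropy_nonneg μ (joinedLabel T ξ n)) n.cast_nonneg
  have hν := div_nonneg (partitionEntropy_nonneg ν (joinedLabel T ξ n)) n.cast_nonneg
  simp only [← ENNReal.ofReal_coe_nnreal]
  rw [← ENNReal.ofReal_mul a.coe_nonneg, ← ENNReal.ofReal_mul b.coe_nonneg,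
    ← ENNReal.ofReal_add (mul_nonneg a.coe_nonneg hμ) (mul_nonneg b.coe_nonneg hν)]
  refine ENNReal.ofReal_le_ofReal ?_
  rw [mul_div_assoc', mul_div_assoc', ← add_div]
  exact div_le_div_of_nonneg_right (partitionEntropy_concave μ ν _ hab) n.cast_nonneg

/-- A single index type lets the scalar and the sum be moved through the supremum. -/
lemma metricEntropy_eq_iSup (T : X → X) (μ : Measure X) :
    metricEntropy T μ =
      ⨆ p : Σ k : ℕ, {ξ : X → Fin k // Measurable ξ}, entropyOfPartition T μ p.2.1 := by
  simp only [metricEntropy, iSup_sigma, iSup_subtype]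

/-- The Kolmogorov–Sinai entropy is concave in the measure. -/
lemma metricEntropy_concave {T : X → X} (hT : Measurable T) (μ ν : Measure X)
    [IsProbabilityMeasure μ] [IsProbabilityMeasure ν] {a b : ℝ≥0} (hab : a + b = 1) :
    a * metricEntropy T μ + b * metricEntropy T ν ≤ metricEntropy T (a • μ + b • ν) := by
  have : Nonempty (Σ k : ℕ, {ξ : X → Fin k // Measurable ξ}) :=
    ⟨⟨1, fun _ => 0, measurable_const⟩⟩
  rw [metricEntropy_eq_iSup T μ, metricEntropy_eq_iSup T ν, ENNReal.mul_iSup, ENNReal.mul_iSup]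
  refine ENNReal.iSup_add_iSup_le ?_
  rintro ⟨k, ξ, hξ⟩ ⟨l, η, hη⟩
  -- The two suprema run over unrelated partitions `ξ` and `η`; their common refinement `ζ`
  -- dominates both.
  let e : Fin k × Fin l ≃ Fin (k * l) := finProdFinEquiv
  let ζ : X → Fin (k * l) := fun x => e (ξ x, η x)
  have hζ : Measurable ζ := (measurable_of_finite e).comp (hξ.prodMk hη)
  have h₁ : (fun c => (e.symm c).1) ∘ ζ = ξ := by ext x; simp [ζ]
  have h₂ : (fun c => (e.symm c).2) ∘ ζ = η := by ext x; simp [ζ]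
  calc
    a * entropyOfPartition T μ ξ + b * entropyOfPartition T ν η
        ≤ a * entropyOfPartition T μ ζ + b * entropyOfPartition T ν ζ := by
      gcongr
      · rw [← h₁]; exact entropyOfPartition_comp_le hT μ hζ _
      · rw [← h₂]; exact entropyOfPartition_comp_le hT ν hζ _
    _ ≤ entropyOfPartition T (a • μ + b • ν) ζ := entropyOfPartition_concave T μ ν ζ hab
    _ ≤ metricEntropy T (a • μ + b • ν) := by
      rw [metricEntropy_eq_iSup]
      exact le_iSup (fun p : Σ k : ℕ, {ξ : X → Fin k // Measurable ξ} =>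
        entropyOfPartition T (a • μ + b • ν) p.2.1) ⟨_, ζ, hζ⟩

/-- The convex combination `a μ + b ν` of two probability measures. -/
noncomputable def convexComb (a b : ℝ≥0) (hab : a + b = 1) (μ ν : ProbabilityMeasure X) :
    ProbabilityMeasure X :=
  ⟨a • (μ : Measure X) + b • (ν : Measure X),
    ⟨by
      rw [Measure.add_apply, Measure.smul_apply, Measure.smul_apply, measure_univ, measure_univ,
        ← add_smul, hab, one_smul]⟩⟩

lemma coe_convexComb (a b : ℝ≥0) (hab : a + b = 1) (μ ν : ProbabilityMeasure X) :
    (convexComb a b hab μ ν : Measure X) = a • (μ : Measure X) + b • (ν : Measure X) :=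
  rfl

lemma convexComb_mem_invariantMeasures {T : X → X} {a b : ℝ≥0} (hab : a + b = 1)
    {μ ν : ProbabilityMeasure X} (hμ : μ ∈ invariantMeasures T) (hν : ν ∈ invariantMeasures T) :
    convexComb a b hab μ ν ∈ invariantMeasures T :=
  (MeasurePreserving.smul_measure hμ a).add_measure (MeasurePreserving.smul_measure hν b)

end Entropy

/-! ### Level sets of the integral map -/

section Level

/-- Invariant measures are the fixed points of the weak*-continuous pushforward by `T`. -/
lemma isClosed_invariantMeasures {X : Type*} [MetricSpace X] [MeasurableSpace X]
    [BorelSpace X] {T : X → X} (hT : Continuous T) :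
    IsClosed (invariantMeasures T) := by
  have : invariantMeasures T =
      {μ : ProbabilityMeasure X | μ.map hT.measurable.aemeasurable = μ} := by
    ext μ
    rw [mem_ofPred_eq, ← ProbabilityMeasure.toMeasure_injective.eq_iff]
    exact ⟨fun h => h.map_eq, fun h => ⟨hT.measurable, h⟩⟩
  rw [this]
  exact isClosed_eq (ProbabilityMeasure.continuous_map hT) continuous_id

lemma metricEntropy_le_levelEntropy {X : Type*} [MetricSpace X] [MeasurableSpace X] {d : ℕ}
    (T : X → X) (Φ : Fin d → C(X, ℝ))
    {μ : ProbabilityMeasure X} (hμ : μ ∈ invariantMeasures T) :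
    metricEntropy T (μ : Measure X) ≤ levelEntropy T Φ (integralVec Φ μ) :=
  le_iSup₂_of_le (f := fun (ρ : ProbabilityMeasure X)
    (_ : ρ ∈ levelMeasures T Φ (integralVec Φ μ)) => metricEntropy T (ρ : Measure X))
    μ ⟨hμ, rfl⟩ le_rfl

variable {X : Type*} [MetricSpace X] [CompactSpace X] [MeasurableSpace X] [BorelSpace X] {d : ℕ}

lemma continuous_integralVec (Φ : Fin d → C(X, ℝ)) : Continuous (integralVec Φ) :=
  (PiLp.continuous_toLp 2 _).comp
    (continuous_pi fun i => ProbabilityMeasure.continuous_integral_continuousMap (Φ i))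

lemma isCompact_levelMeasures {T : X → X} (hT : Continuous T) (Φ : Fin d → C(X, ℝ))
    (z : EuclideanSpace ℝ (Fin d)) : IsCompact (levelMeasures T Φ z) :=
  ((isClosed_invariantMeasures hT).inter
    (isClosed_singleton.preimage (continuous_integralVec Φ))).isCompact

lemma integralVec_convexComb (Φ : Fin d → C(X, ℝ)) {a b : ℝ≥0} (hab : a + b = 1)
    (μ ν : ProbabilityMeasure X) :
    integralVec Φ (convexComb a b hab μ ν) =
      (a : ℝ) • integralVec Φ μ + (b : ℝ) • integralVec Φ ν := by
  ext i
  have hi (ρ : Measure X) [IsFiniteMeasure ρ] : Integrable (Φ i) ρ :=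
    (Φ i).continuous.integrable_of_hasCompactSupport (HasCompactSupport.of_compactSpace _)
  change ∫ x, Φ i x ∂(a • (μ : Measure X) + b • (ν : Measure X)) =
    (a : ℝ) * ∫ x, Φ i x ∂(μ : Measure X) + (b : ℝ) * ∫ x, Φ i x ∂(ν : Measure X)
  rw [integral_add_measure (hi _) (hi _), integral_smul_nnreal_measure,
    integral_smul_nnreal_measure]
  rfl

/-- If the entropy map is finite and upper semicontinuous, then the supremum defining `h(z)`
is attained. -/
lemma exists_metricEntropy_eq_levelEntropy {T : X → X} (hT : Continuous T)
    (Φ : Fin d → C(X, ℝ))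
    (hfin : ∀ μ ∈ invariantMeasures T, metricEntropy T (μ : Measure X) ≠ ⊤)
    (husc : UpperSemicontinuousOn
      (fun μ : ProbabilityMeasure X => (metricEntropy T (μ : Measure X)).toReal)
      (invariantMeasures T))
    {z : EuclideanSpace ℝ (Fin d)} (hz : z ∈ rotationSet T Φ) :
    ∃ μ ∈ levelMeasures T Φ z, levelEntropy T Φ z = metricEntropy T (μ : Measure X) := by
  obtain ⟨ν, hν, hνz⟩ := hz
  obtain ⟨μ, hμ, hmax⟩ := UpperSemicontinuousOn.exists_isMaxOn
    (s := levelMeasures T Φ z) ⟨ν, hν, hνz⟩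
    (isCompact_levelMeasures hT Φ z) (husc.mono fun _ h => h.1)
  refine ⟨μ, hμ, le_antisymm (iSup₂_le fun ρ hρ => ?_) (le_iSup₂_of_le μ hμ le_rfl)⟩
  -- Maximality is known only after `toReal`; finiteness transfers it back to `ℝ≥0∞`.
  exact (ENNReal.toReal_le_toReal (hfin ρ hρ.1) (hfin μ hμ.1)).1 (hmax hρ)

lemma levelEntropy_ne_top {T : X → X} (hT : Continuous T) (Φ : Fin d → C(X, ℝ))
    (hfin : ∀ μ ∈ invariantMeasures T, metricEntropy T (μ : Measure X) ≠ ⊤)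
    (husc : UpperSemicontinuousOn
      (fun μ : ProbabilityMeasure X => (metricEntropy T (μ : Measure X)).toReal)
      (invariantMeasures T))
    {z : EuclideanSpace ℝ (Fin d)} (hz : z ∈ rotationSet T Φ) : levelEntropy T Φ z ≠ ⊤ := by
  obtain ⟨μ, hμ, h⟩ := exists_metricEntropy_eq_levelEntropy hT Φ hfin husc hz
  exact h ▸ hfin μ hμ.1

lemma upperSemicontinuousOn_levelEntropy {T : X → X} (hT : Continuous T) (Φ : Fin d → C(X, ℝ))
    (hfin : ∀ μ ∈ invariantMeasures T, metricEntropy T (μ : Measure X) ≠ ⊤)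
    (husc : UpperSemicontinuousOn
      (fun μ : ProbabilityMeasure X => (metricEntropy T (μ : Measure X)).toReal)
      (invariantMeasures T)) :
    UpperSemicontinuousOn (fun z => (levelEntropy T Φ z).toReal) (rotationSet T Φ) := by
  rw [upperSemicontinuousOn_iff_preimage_Ici]
  intro c
  refine ⟨integralVec Φ '' (invariantMeasures T ∩
    (fun μ : ProbabilityMeasure X => (metricEntropy T (μ : Measure X)).toReal) ⁻¹' Ici c),
    ((husc.isCompact_inter_preimage_Ici (isClosed_invariantMeasures hT).isCompact c).image
      (continuous_integralVec Φ)).isClosed, ?_⟩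
  ext z
  refine and_congr_right fun hz => ⟨fun hc => ?_, ?_⟩
  -- Attainment is essential: a supremum at least `c` must yield one measure with entropy at least
  -- `c`.
  · obtain ⟨μ, hμ, h⟩ := exists_metricEntropy_eq_levelEntropy hT Φ hfin husc hz
    refine ⟨μ, ⟨hμ.1, ?_⟩, hμ.2⟩
    rw [mem_preimage, mem_Ici, h] at hc
    exact hc
  · rintro ⟨μ, ⟨hμ, hc⟩, rfl⟩
    exact le_trans hc (ENNReal.toReal_mono (levelEntropy_ne_top hT Φ hfin husc hz)
      (metricEntropy_le_levelEntropy T Φ hμ))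

lemma convex_rotationSet (T : X → X) (Φ : Fin d → C(X, ℝ)) : Convex ℝ (rotationSet T Φ) := by
  rintro _ ⟨μ, hμ, rfl⟩ _ ⟨ν, hν, rfl⟩ a b ha hb hab
  lift a to ℝ≥0 using ha
  lift b to ℝ≥0 using hb
  have hab' : a + b = 1 := by exact_mod_cast hab
  exact ⟨_, convexComb_mem_invariantMeasures hab' hμ hν, integralVec_convexComb Φ hab' μ ν⟩

lemma levelEntropy_concave {T : X → X} (hT : Continuous T) (Φ : Fin d → C(X, ℝ))
    (hfin : ∀ μ ∈ invariantMeasures T, metricEntropy T (μ : Measure X) ≠ ⊤)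
    (husc : UpperSemicontinuousOn
      (fun μ : ProbabilityMeasure X => (metricEntropy T (μ : Measure X)).toReal)
      (invariantMeasures T))
    {y z : EuclideanSpace ℝ (Fin d)} (hy : y ∈ rotationSet T Φ) (hz : z ∈ rotationSet T Φ)
    {a b : ℝ≥0} (hab : a + b = 1) :
    a * levelEntropy T Φ y + b * levelEntropy T Φ z ≤
      levelEntropy T Φ ((a : ℝ) • y + (b : ℝ) • z) := by
  obtain ⟨μ, hμ, hyμ⟩ := exists_metricEntropy_eq_levelEntropy hT Φ hfin husc hy
  obtain ⟨ν, hν, hzν⟩ := exists_metricEntropy_eq_levelEntropy hT Φ hfin husc hz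
  -- The mixture of the two maximizers competes in the supremum at the mixed point.
  have hle := metricEntropy_le_levelEntropy T Φ (convexComb_mem_invariantMeasures hab hμ.1 hν.1)
  rw [integralVec_convexComb, coe_convexComb, hμ.2, hν.2] at hle
  rw [hyμ, hzν]
  exact (metricEntropy_concave hT.measurable _ _ hab).trans hle

lemma concaveOn_levelEntropy {T : X → X} (hT : Continuous T) (Φ : Fin d → C(X, ℝ))
    (hfin : ∀ μ ∈ invariantMeasures T, metricEntropy T (μ : Measure X) ≠ ⊤)
    (husc : UpperSemicontinuousOn
      (fun μ : ProbabilityMeasure X => (metricEntropy T (μ : Measure X)).toReal)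
      (invariantMeasures T)) :
    ConcaveOn ℝ (rotationSet T Φ) (fun z => (levelEntropy T Φ z).toReal) := by
  refine ⟨convex_rotationSet T Φ, fun y hy z hz a b ha hb hab => ?_⟩
  have hyz := convex_rotationSet T Φ hy hz ha hb hab
  have hab' : a.toNNReal + b.toNNReal = 1 := by
    rw [← Real.toNNReal_add ha hb, hab, Real.toNNReal_one]
  have hle := levelEntropy_concave hT Φ hfin husc hy hz hab'
  rw [Real.coe_toNNReal a ha, Real.coe_toNNReal b hb] at hle
  have h := ENNReal.toReal_mono (levelEntropy_ne_top hT Φ hfin husc hyz) hle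
  rw [ENNReal.toReal_add
    (ENNReal.mul_ne_top ENNReal.coe_ne_top (levelEntropy_ne_top hT Φ hfin husc hy))
    (ENNReal.mul_ne_top ENNReal.coe_ne_top (levelEntropy_ne_top hT Φ hfin husc hz)),
    ENNReal.toReal_mul, ENNReal.toReal_mul, ENNReal.coe_toReal, ENNReal.coe_toReal,
    Real.coe_toNNReal a ha, Real.coe_toNNReal b hb] at h
  exact h

end Level

end NonlinearPressure

theorem mainTheorem7 {X : Type*} [MetricSpace X] [CompactSpace X] [MeasurableSpace X]
    [BorelSpace X] {d : ℕ} (T : X → X) (hT : Continuous T) (Φ : Fin d → C(X, ℝ))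
    (r : WithTop ℕ∞) (hr : 2 ≤ r) (hreg : NonlinearPressure.IsRegularPair r T Φ) :
    (∀ z ∈ NonlinearPressure.rotationSet T Φ, NonlinearPressure.levelEntropy T Φ z ≠ ⊤) ∧
    UpperSemicontinuousOn (fun z => (NonlinearPressure.levelEntropy T Φ z).toReal)
      (NonlinearPressure.rotationSet T Φ) ∧
    ConcaveOn ℝ (NonlinearPressure.rotationSet T Φ)
      (fun z => (NonlinearPressure.levelEntropy T Φ z).toReal) :=
  have hfin := hreg.entropy_finite
  have husc := hreg.entropy_usc
  ⟨fun _ hz => NonlinearPressure.levelEntropy_ne_top hT Φ hfin husc hz,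
    NonlinearPressure.upperSemicontinuousOn_levelEntropy hT Φ hfin husc,
    NonlinearPressure.concaveOn_levelEntropy hT Φ hfin husc⟩
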